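/- Theorem (Partial sum property for cones). Let $\mathcal H$ be a real Hilbert space and let $(K_i)_{i\in I}$ be a finite family of nonempty closed convex cones in $\mathcal H$. For a nonempty closed convex set $C\subseteq\mathcal H$, let $P_C$ be the projector onto $C$, which sends each point to its nearest point in $C$. Let $\Gamma_0(\mathcal H)$ be the set of proper, convex, lower semicontinuous functions from $\mathcal H$ to $\left]-\infty,+\infty\right]$; the proximity operator of $f\in\Gamma_0(\mathcal H)$ sends each $x\in\mathcal H$ to the unique minimizer of $y\mapsto f(y)+\tfrac12\|x-y\|^2$. Sums of sets are Minkowski sums; the empty sum of sets is $\{0\}$, and the empty sum of operators is $0$. Then the following are equivalent: (i) For every $(i,j)\in I\times I$ with $i\neq j$ and every $x\in\mathcal H$, $\langle P_{K_i}x, P_{K_j}x\rangle=0$. (ii) $\sum_{i\in I}K_i$ is closed and $\sum_{i\in I}P_{K_i}=P_{\sum_{i\in I}K_i}$. (iii) $\sum_{i\in I}P_{K_i}$ is the projector onto a nonempty closed convex cone in $\mathcal H$. (iv) $\sum_{i\in I}P_{K_i}$ is the proximity operator of a function in $\Gamma_0(\mathcal H)$. (v) For every nonempty subset $J$ of $I$,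 $\sum_{j\in J}P_{K_j}$ is the proximity operator of a function in $\Gamma_0(\mathcal H)$. (vi) For every nonempty subset $J$ of $I$, $\sum_{j\in J}K_j$ is closed and $\sum_{j\in J}P_{K_j}=P_{\sum_{j\in J}K_j}$. (vii) For every $(i,j)\in I\times I$ with $i\neq j$, $P_{K_i}+P_{K_j}$ is nonexpansive, i.e. $\|P_{K_i}x+P_{K_j}x-P_{K_i}y-P_{K_j}y\|\le\|x-y\|$ for all $x,y\in\mathcal H$. (viii) For every $(i,j)\in I\times I$ with $i\neq j$, the operator $T=\mathrm{Id}-P_{K_i}-P_{K_j}$ is monotone, i.e. $\langle x-y, Tx-Ty\rangle\ge 0$ for all $x,y\in\mathcal H$. -/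

import Mathlib

open scoped Pointwise

namespace ConeSum

variable {H : Type*} [NormedAddCommGroup H] [InnerProductSpace ℝ H]

/-- `p` is a point of `C` nearest to `x`. -/
def IsNearest (C : Set H) (x p : H) : Prop :=
  p ∈ C ∧ ∀ y ∈ C, ‖x - p‖ ≤ ‖x - y‖

open Classical in
/-- The projector `P_C`, which sends `x` to the nearest point of `C`. It is meaningful when `C` is
nonempty, closed and convex in a Hilbert space (see `eq_proj_iff`); the value is `0` at a point
that has no nearest point in `C`. -/
noncomputable def proj (C : Set H) (x : H) : H :=
  if h : ∃ p, IsNearest C x p then h.choose else 0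

/-- In a Hilbert space, `proj C x` is the one and only point nearest to `x` in a nonempty closed
convex set `C`. -/
theorem eq_proj_iff [CompleteSpace H] {C : Set H} (hne : C.Nonempty) (hcl : IsClosed C)
    (hcv : Convex ℝ C) (x p : H) : p = proj C x ↔ IsNearest C x p := by
  have hex : ∃ p, IsNearest C x p := by
    obtain ⟨v, hv, hmin⟩ := exists_norm_eq_iInf_of_complete_convex hne hcl.isComplete hcv x
    refine ⟨v, hv, fun y hy => ?_⟩
    rw [hmin]
    exact ciInf_le (f := fun w : C => ‖x - w‖) ⟨0, by rintro _ ⟨w, rfl⟩; exact norm_nonneg _⟩ ⟨y, hy⟩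
  have hproj : IsNearest C x (proj C x) := by
    unfold proj
    rw [dif_pos hex]
    exact hex.choose_spec
  have key : ∀ {q : H}, IsNearest C x q → ∀ w ∈ C, inner ℝ (x - q) (w - q) ≤ 0 := by
    intro q hq
    refine (norm_eq_iInf_iff_real_inner_le_zero hcv hq.1).1 (le_antisymm ?_ ?_)
    · have : Nonempty C := hne.to_subtype
      exact le_ciInf fun w => hq.2 w w.2
    · exact ciInf_le (f := fun w : C => ‖x - w‖) ⟨0, by rintro _ ⟨w, rfl⟩; exact norm_nonneg _⟩
        ⟨q, hq.1⟩
  refine ⟨fun h => h ▸ hproj, fun hp => ?_⟩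
  have h1 := key hp _ hproj.1
  have h2 := key hproj _ hp.1
  have h3 : inner ℝ (p - proj C x) (p - proj C x) ≤ 0 := by
    simp only [inner_sub_left, inner_sub_right] at h1 h2 ⊢
    linarith [real_inner_comm (proj C x) p]
  rw [real_inner_self_eq_norm_sq] at h3
  have h4 : ‖p - proj C x‖ = 0 := by nlinarith [norm_nonneg (p - proj C x)]
  exact sub_eq_zero.1 (norm_eq_zero.1 h4)

/-- The class `Γ₀(H)` of convex, lower semicontinuous, proper functions from `H` to `]-∞, +∞]`;
convexity means convexity of the epigraph. -/
structure IsGammaZero (f : H → EReal) : Prop where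
  ne_bot : ∀ x, f x ≠ ⊥
  exists_ne_top : ∃ x, f x ≠ ⊤
  convex : Convex ℝ {p : H × ℝ | f p.1 ≤ (p.2 : EReal)}
  lsc : LowerSemicontinuous f

/-- `T` is the proximity operator of `f`: for every `x`, the point `T x` is the unique minimizer
of `y ↦ f y + (1/2) ‖x - y‖²`. -/
def IsProxOf (f : H → EReal) (T : H → H) : Prop :=
  ∀ x p : H, p = T x ↔
    ∀ y : H, f p + ((1 / 2 * ‖x - p‖ ^ 2 : ℝ) : EReal) ≤ f y + ((1 / 2 * ‖x - y‖ ^ 2 : ℝ) : EReal)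

/-- `T` is the proximity operator of some function in `Γ₀(H)`. -/
def IsProximityOperator (T : H → H) : Prop :=
  ∃ f : H → EReal, IsGammaZero f ∧ IsProxOf f T

/-- `T` is the projector onto some nonempty closed convex cone. -/
def IsConeProjector (T : H → H) : Prop :=
  ∃ K : ConvexCone ℝ H, (K : Set H).Nonempty ∧ IsClosed (K : Set H) ∧ T = proj (K : Set H)

/-- `T` is nonexpansive. -/
def IsNonexpansive (T : H → H) : Prop :=
  ∀ x y : H, ‖T x - T y‖ ≤ ‖x - y‖

/-- `T` is monotone in the sense of operator theory. -/
def IsMonotoneOperator (T : H → H) : Prop :=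
  ∀ x y : H, 0 ≤ inner ℝ (x - y) (T x - T y)

end ConeSum

open ConeSum

open scoped RealInnerProductSpace

namespace ConeSum

variable {H : Type*} [NormedAddCommGroup H] [InnerProductSpace ℝ H]

/-! ### Limiting arguments for real inequalities -/

section Scalar

/-! Everything passes through the pairwise orthogonality (i). It allows the K-component of x to be
removed without changing the projection onto L (`proj_sub_proj_of_orthogonal`). Hence, with p the
sum of the projections of x, the residual x - p is polar to every summand cone and orthogonal to p,
so p is a nearest point to x in the sum of the cones. A set that has a nearest point to every point
is closed.

Conversely, a proximity operator T is firmly nonexpansive, hence nonexpansive, so Id - T is monotone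
by Cauchy–Schwarz. Monotonicity of Id minus the sum of the projectors, tested on pairs (k, 0) and
(x, t P x), forces orthogonality (`inner_proj_eq_zero_of_isMonotoneOperator`). This is applied to
the whole family and to pairs. -/

theorem nonpos_of_forall_le_mul {a b : ℝ} (h : ∀ t : ℝ, 0 < t → t < 1 → a ≤ t * b) : a ≤ 0 := by
  by_contra! ha
  have hb := h (1 / 2) (by norm_num) (by norm_num)
  have hb0 : 0 < b := by linarith
  have hlt : a / (2 * b) < 1 := by
    rw [div_lt_one (by positivity)]
    linarith
  have h1 := h (a / (2 * b)) (by positivity) hlt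
  have h2 : a / (2 * b) * b = a / 2 := by field_simp
  linarith

theorem nonpos_of_forall_mul_le {a b : ℝ} (h : ∀ t : ℝ, 0 < t → t * a ≤ b) : a ≤ 0 := by
  by_contra! ha
  have h1 := h ((|b| + 1) / a) (by positivity)
  rw [div_mul_cancel₀ _ ha.ne'] at h1
  linarith [le_abs_self b]

end Scalar

/-! ### Projectors onto closed convex sets -/

section Projector

theorem isNearest_of_inner_le_zero {C : Set H} {x p : H} (hp : p ∈ C)
    (h : ∀ y ∈ C, ⟪x - p, y - p⟫ ≤ 0) : IsNearest C x p := by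
  refine ⟨hp, fun y hy => ?_⟩
  refine le_of_sq_le_sq ?_ (norm_nonneg _)
  have h1 : x - y = (x - p) - (y - p) := by abel
  rw [h1, norm_sub_sq_real (x - p) (y - p)]
  nlinarith [h y hy, sq_nonneg ‖y - p‖]

variable [CompleteSpace H]

theorem proj_mem_and_inner_le_zero {C : Set H} (hne : C.Nonempty) (hcl : IsClosed C)
    (hcv : Convex ℝ C) (x : H) :
    proj C x ∈ C ∧ ∀ y ∈ C, ⟪x - proj C x, y - proj C x⟫ ≤ 0 := by
  obtain ⟨v, hv, hmin⟩ := exists_norm_eq_iInf_of_complete_convex hne hcl.isComplete hcv x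
  have hle := (norm_eq_iInf_iff_real_inner_le_zero hcv hv).1 hmin
  have hproj := (eq_proj_iff hne hcl hcv x v).2 (isNearest_of_inner_le_zero hv hle)
  exact hproj ▸ ⟨hv, hle⟩

theorem norm_proj_sub_sq_le_inner {C : Set H} (hne : C.Nonempty) (hcl : IsClosed C)
    (hcv : Convex ℝ C) (x y : H) :
    ‖proj C x - proj C y‖ ^ 2 ≤ ⟪x - y, proj C x - proj C y⟫ := by
  obtain ⟨hx, hx'⟩ := proj_mem_and_inner_le_zero hne hcl hcv x
  obtain ⟨hy, hy'⟩ := proj_mem_and_inner_le_zero hne hcl hcv y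
  have h1 := hx' _ hy
  have h2 := hy' _ hx
  rw [← real_inner_self_eq_norm_sq]
  simp only [inner_sub_left, inner_sub_right] at h1 h2 ⊢
  linarith [real_inner_comm (proj C x) (proj C y)]

/-- The function is the indicator of C: 0 on C and ⊤ elsewhere. Its sublevel sets are the whole
space, C and the empty set. -/
theorem isProximityOperator_proj {C : Set H} (hne : C.Nonempty) (hcl : IsClosed C)
    (hcv : Convex ℝ C) : IsProximityOperator (proj C) := by
  classical
  refine ⟨fun x => if x ∈ C then 0 else ⊤, ⟨fun x => ?_, ?_, ?_, ?_⟩, fun x p => ?_⟩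
  · split_ifs <;> simp
  · obtain ⟨x, hx⟩ := hne
    exact ⟨x, by simp [hx]⟩
  · have : {p : H × ℝ | (if p.1 ∈ C then (0 : EReal) else ⊤) ≤ (p.2 : EReal)} =
        C ×ˢ Set.Ici 0 := by
      ext ⟨y, r⟩
      by_cases hy : y ∈ C <;> simp [hy]
    rw [this]
    exact hcv.prod (convex_Ici 0)
  · rw [lowerSemicontinuous_iff_isClosed_preimage]
    intro a
    by_cases ha : a = ⊤
    · simp [ha]
    by_cases ha0 : 0 ≤ a
    · have : (fun x => if x ∈ C then (0 : EReal) else ⊤) ⁻¹' Set.Iic a = C := by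
        ext y
        by_cases hy : y ∈ C <;> simp [hy, ha, ha0]
      rwa [this]
    · have : (fun x => if x ∈ C then (0 : EReal) else ⊤) ⁻¹' Set.Iic a = ∅ := by
        ext y
        by_cases hy : y ∈ C <;> simp [hy, ha, not_le.1 ha0]
      rw [this]
      exact isClosed_empty
  · rw [eq_proj_iff hne hcl hcv]
    have hsq : ∀ y, ((1 / 2 * ‖x - p‖ ^ 2 : ℝ) : EReal) ≤ ((1 / 2 * ‖x - y‖ ^ 2 : ℝ) : EReal) ↔
        ‖x - p‖ ≤ ‖x - y‖ := fun y => by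
      rw [EReal.coe_le_coe_iff, mul_le_mul_iff_right₀ (by norm_num),
        sq_le_sq₀ (norm_nonneg _) (norm_nonneg _)]
    constructor
    · rintro ⟨hp, hmin⟩ y
      by_cases hy : y ∈ C
      · simpa only [hp, hy, if_true, zero_add] using (hsq y).2 (hmin y hy)
      · beta_reduce
        rw [if_neg hy, EReal.top_add_coe]
        exact le_top
    · intro h
      have hp : p ∈ C := by
        by_contra hp
        obtain ⟨y, hy⟩ := hne
        have := h y
        beta_reduce at this
        rw [if_neg hp, if_pos hy, EReal.top_add_coe, zero_add, top_le_iff] at this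
        exact EReal.coe_ne_top _ this
      refine ⟨hp, fun y hy => (hsq y).1 ?_⟩
      simpa only [hp, hy, if_true, zero_add] using h y

end Projector

/-! ### Proximity operators and monotonicity -/

section Proximity

theorem IsProxOf.apply_ne_top {f : H → EReal} {T : H → H} (hf : IsGammaZero f)
    (hT : IsProxOf f T) (x : H) : f (T x) ≠ ⊤ := by
  intro htop
  obtain ⟨y, hy⟩ := hf.exists_ne_top
  have h := (hT x (T x)).1 rfl y
  rw [htop, EReal.top_add_coe, top_le_iff] at h
  exact EReal.add_ne_top hy (EReal.coe_ne_top _) h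

/-- Compare the minimizer with points of the segment towards q, using convexity; after division by
t, the quadratic remainder vanishes as t → 0. -/
theorem IsProxOf.inner_le_sub {f : H → EReal} {T : H → H} (hf : IsGammaZero f)
    (hT : IsProxOf f T) (x q : H) (hq : f q ≠ ⊤) :
    ⟪x - T x, q - T x⟫ ≤ (f q).toReal - (f (T x)).toReal := by
  set p := T x with hp
  have hfp : f p = ((f p).toReal : EReal) :=
    (EReal.coe_toReal (hT.apply_ne_top hf x) (hf.ne_bot p)).symm
  have hfq : f q = ((f q).toReal : EReal) := (EReal.coe_toReal hq (hf.ne_bot q)).symm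
  set a := (f p).toReal
  set b := (f q).toReal
  suffices h : ⟪x - p, q - p⟫ - (b - a) ≤ 0 by linarith
  refine nonpos_of_forall_le_mul (b := 1 / 2 * ‖q - p‖ ^ 2) fun t ht0 ht1 => ?_
  have hconv := hf.convex (x := (p, a)) (y := (q, b)) hfp.le hfq.le
    (sub_nonneg.2 ht1.le) ht0.le (sub_add_cancel 1 t)
  simp only [Prod.smul_mk, Prod.mk_add_mk, Set.mem_ofPred_eq, smul_eq_mul] at hconv
  have hmin := ((hT x p).1 hp ((1 - t) • p + t • q)).trans (add_le_add_left hconv _)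
  rw [hfp, ← EReal.coe_add, ← EReal.coe_add, EReal.coe_le_coe_iff] at hmin
  have hz : x - ((1 - t) • p + t • q) = (x - p) - t • (q - p) := by
    simp only [sub_smul, smul_sub, one_smul]
    abel
  rw [hz, norm_sub_sq_real (x - p) (t • (q - p)), inner_smul_right, norm_smul, mul_pow, Real.norm_eq_abs, sq_abs] at hmin
  refine le_of_mul_le_mul_left ?_ ht0
  linarith

/-- Adding the variational inequalities at x and y, each tested at the other's image, cancels the
values of f. -/
theorem IsProximityOperator.norm_sub_sq_le_inner {T : H → H} (hT : IsProximityOperator T)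
    (x y : H) : ‖T x - T y‖ ^ 2 ≤ ⟪x - y, T x - T y⟫ := by
  obtain ⟨f, hf, hT⟩ := hT
  have h1 := hT.inner_le_sub hf x (T y) (hT.apply_ne_top hf y)
  have h2 := hT.inner_le_sub hf y (T x) (hT.apply_ne_top hf x)
  rw [← real_inner_self_eq_norm_sq]
  simp only [inner_sub_left, inner_sub_right] at h1 h2 ⊢
  linarith [real_inner_comm (T x) (T y)]

theorem IsProximityOperator.isNonexpansive {T : H → H} (hT : IsProximityOperator T) :
    IsNonexpansive T := by
  intro x y
  have h := (hT.norm_sub_sq_le_inner x y).trans (real_inner_le_norm _ _)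
  rw [sq] at h
  by_contra! hlt
  nlinarith [norm_nonneg (x - y)]

theorem IsNonexpansive.isMonotoneOperator_sub {T : H → H} (hT : IsNonexpansive T) :
    IsMonotoneOperator fun x => x - T x := by
  intro x y
  have h1 : x - T x - (y - T y) = (x - y) - (T x - T y) := by abel
  have h2 := real_inner_le_norm (x - y) (T x - T y)
  rw [h1, inner_sub_right, real_inner_self_eq_norm_sq]
  nlinarith [hT x y, norm_nonneg (x - y)]

end Proximity

/-! ### Projectors onto closed convex cones -/

section Cone

/-- A `ConvexCone` is only stable under positive scaling, so 0 is reached as the limit of t • k as t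
→ 0. -/
theorem zero_mem_cone {K : ConvexCone ℝ H} (hne : (K : Set H).Nonempty) (hcl : IsClosed (K : Set H)) : (0 : H) ∈ K := by
  obtain ⟨k, hk⟩ := hne
  have : Filter.Tendsto (fun t : ℝ => t • k) (nhdsWithin 0 (Set.Ioi 0)) (nhds 0) := by
    have h : Filter.Tendsto (fun t : ℝ => t • k) (nhds 0) (nhds ((0 : ℝ) • k)) :=
      (continuous_id.smul continuous_const).tendsto 0
    rw [zero_smul] at h
    exact h.mono_left nhdsWithin_le_nhds
  exact hcl.mem_of_tendsto this
    (Filter.eventually_of_mem self_mem_nhdsWithin fun t ht => K.smul_mem ht hk)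

variable [CompleteSpace H]

theorem eq_proj_cone_iff {K : ConvexCone ℝ H} (hne : (K : Set H).Nonempty)
    (hcl : IsClosed (K : Set H)) {x p : H} :
    p = proj (K : Set H) x ↔ p ∈ K ∧ ⟪x - p, p⟫ = 0 ∧ ∀ k ∈ K, ⟪x - p, k⟫ ≤ 0 := by
  constructor
  · rintro rfl
    obtain ⟨hp, h⟩ := proj_mem_and_inner_le_zero hne hcl K.convex x
    set p := proj (K : Set H) x
    have hpol : ∀ k ∈ K, ⟪x - p, k⟫ ≤ 0 := fun k hk => by
      simpa using h (p + k) (K.add_mem hp hk)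
    refine ⟨hp, le_antisymm (hpol p hp) ?_, hpol⟩
    -- Shrinking p inside the cone gives the reverse inequality.
    have := h ((1 / 2 : ℝ) • p) (K.smul_mem (by norm_num) hp)
    rw [inner_sub_right, inner_smul_right] at this
    linarith
  · rintro ⟨hp, horth, hpol⟩
    refine (eq_proj_iff hne hcl K.convex x p).2 (isNearest_of_inner_le_zero hp fun y hy => ?_)
    rw [inner_sub_right, horth, sub_zero]
    exact hpol y hy

variable {K L : ConvexCone ℝ H}

theorem proj_mem (hne : (K : Set H).Nonempty) (hcl : IsClosed (K : Set H)) (x : H) :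
    proj (K : Set H) x ∈ K :=
  ((eq_proj_cone_iff hne hcl).1 rfl).1

theorem inner_sub_proj_self (hne : (K : Set H).Nonempty) (hcl : IsClosed (K : Set H)) (x : H) :
    ⟪x - proj (K : Set H) x, proj (K : Set H) x⟫ = 0 :=
  ((eq_proj_cone_iff hne hcl).1 rfl).2.1

theorem inner_sub_proj_nonpos (hne : (K : Set H).Nonempty) (hcl : IsClosed (K : Set H)) (x : H)
    {k : H} (hk : k ∈ K) : ⟪x - proj (K : Set H) x, k⟫ ≤ 0 :=
  ((eq_proj_cone_iff hne hcl).1 rfl).2.2 k hk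

theorem inner_proj (hne : (K : Set H).Nonempty) (hcl : IsClosed (K : Set H)) (x : H) :
    ⟪x, proj (K : Set H) x⟫ = ‖proj (K : Set H) x‖ ^ 2 := by
  have := inner_sub_proj_self hne hcl x
  rwa [inner_sub_left, sub_eq_zero, real_inner_self_eq_norm_sq] at this

theorem proj_of_mem (hne : (K : Set H).Nonempty) (hcl : IsClosed (K : Set H)) {x : H}
    (hx : x ∈ K) : proj (K : Set H) x = x :=
  ((eq_proj_cone_iff hne hcl).2 ⟨hx, by simp, by simp⟩).symm

/-- The residual is still x - P x, so the polarity and orthogonality conditions carry over. -/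
theorem proj_sub_smul_proj (hne : (K : Set H).Nonempty) (hcl : IsClosed (K : Set H)) (x : H)
    {t : ℝ} (ht : t < 1) :
    proj (K : Set H) (x - t • proj (K : Set H) x) = (1 - t) • proj (K : Set H) x := by
  symm
  have hsub : x - t • proj (K : Set H) x - (1 - t) • proj (K : Set H) x =
      x - proj (K : Set H) x := by
    rw [sub_smul, one_smul]
    abel
  rw [eq_proj_cone_iff hne hcl, hsub, inner_smul_right, inner_sub_proj_self hne hcl, mul_zero]
  exact ⟨K.smul_mem (sub_pos.2 ht) (proj_mem hne hcl x), rfl,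
    fun k hk => inner_sub_proj_nonpos hne hcl x hk⟩

/-- If the projections onto `K` and `L` are always orthogonal, removing the `K`-component of a
point does not affect its projection onto `L`. -/
theorem proj_sub_proj_of_orthogonal (hKne : (K : Set H).Nonempty) (hKcl : IsClosed (K : Set H))
    (hLne : (L : Set H).Nonempty) (hLcl : IsClosed (L : Set H))
    (h : ∀ x : H, ⟪proj (K : Set H) x, proj (L : Set H) x⟫ = 0) (x : H) :
    proj (L : Set H) (x - proj (K : Set H) x) = proj (L : Set H) x := by
  set u := proj (K : Set H) x with hu
  set q := proj (L : Set H) (x - u) with hq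
  -- At x - u the projection onto K vanishes and orthogonality says nothing. At x - (1 - t) • u it
  -- is t • u, so u ⟂ q'; then let t → 0, since q' is within t‖u‖ of q.
  have hqu : -⟪u, q⟫ ≤ 0 := by
    refine nonpos_of_forall_le_mul (b := ‖u‖ * ‖u‖) fun t ht0 ht1 => ?_
    set q' := proj (L : Set H) (x - (1 - t) • u) with hq'
    have horth := h (x - (1 - t) • u)
    rw [hu, proj_sub_smul_proj hKne hKcl x (by linarith : 1 - t < 1), ← hu, ← hq',
      inner_smul_left, mul_eq_zero] at horth
    have horth' : ⟪u, q'⟫ = 0 := horth.resolve_left (by simpa using ht0.ne')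
    have hdiff : x - u - (x - (1 - t) • u) = -(t • u) := by
      rw [sub_smul, one_smul]
      abel
    have h1 : ‖q - q'‖ ≤ t * ‖u‖ := by
      have h2 := norm_proj_sub_sq_le_inner hLne hLcl L.convex (x - u) (x - (1 - t) • u)
      have h3 := h2.trans (real_inner_le_norm _ _)
      rw [hdiff, norm_neg, norm_smul, Real.norm_of_nonneg ht0.le, ← hq, ← hq'] at h3
      by_contra! hlt
      have : 0 ≤ t * ‖u‖ := by positivity
      nlinarith
    have h4 := neg_le_of_abs_le (abs_real_inner_le_norm u (q - q'))
    rw [inner_sub_right, horth', sub_zero] at h4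
    nlinarith [mul_le_mul_of_nonneg_left h1 (norm_nonneg u)]
  -- Firm nonexpansiveness bounds the squared distance by -⟪u, q⟫, because u is orthogonal to the
  -- projection of x onto L.
  have hfirm := norm_proj_sub_sq_le_inner hLne hLcl L.convex (x - u) x
  rw [← hq, sub_sub_cancel_left, inner_neg_left, inner_sub_right, h x] at hfirm
  have : ‖q - proj (L : Set H) x‖ ^ 2 = 0 := le_antisymm (by linarith) (sq_nonneg _)
  rwa [sq_eq_zero_iff, norm_eq_zero, sub_eq_zero] at this

end Cone

/-! ### Sums of cones and of their projectors -/

section Sum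

variable {ι : Type*} {K : ι → ConvexCone ℝ H}

theorem exists_convexCone_coe_eq_sum (K : ι → ConvexCone ℝ H) (J : Finset ι) :
    ∃ L : ConvexCone ℝ H, (L : Set H) = ∑ j ∈ J, (K j : Set H) := by
  classical
  induction J using Finset.induction_on with
  | empty => exact ⟨0, by simp⟩
  | insert i J hi ih =>
    obtain ⟨L, hL⟩ := ih
    exact ⟨K i + L, by rw [Finset.sum_insert hi, ConvexCone.coe_add, hL]⟩

theorem nonempty_sum (hne : ∀ i, (K i : Set H).Nonempty) (J : Finset ι) :
    (∑ j ∈ J, (K j : Set H)).Nonempty :=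
  ⟨_, Set.finsetSum_mem_finsetSum J _ _ fun i _ => (hne i).some_mem⟩

theorem isConeProjector_sum (hne : ∀ i, (K i : Set H).Nonempty) {J : Finset ι}
    (hcl : IsClosed (∑ j ∈ J, (K j : Set H)))
    (h : ∀ x : H, ∑ j ∈ J, proj (K j : Set H) x = proj (∑ j ∈ J, (K j : Set H)) x) :
    IsConeProjector fun x : H => ∑ j ∈ J, proj (K j : Set H) x := by
  obtain ⟨L, hL⟩ := exists_convexCone_coe_eq_sum K J
  refine ⟨L, ?_, ?_, ?_⟩
  · rw [hL]
    exact nonempty_sum hne J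
  · rwa [hL]
  · rw [hL]
    exact funext h

variable [CompleteSpace H]

/-- The components are peeled off one at a time: by induction the l-component of the current
remainder is still that of x. -/
theorem proj_sub_sum_proj (hne : ∀ i, (K i : Set H).Nonempty)
    (hcl : ∀ i, IsClosed (K i : Set H))
    (h : ∀ i j, i ≠ j → ∀ x : H, ⟪proj (K i : Set H) x, proj (K j : Set H) x⟫ = 0)
    (S : Finset ι) {i : ι} (hi : i ∉ S) (x : H) :
    proj (K i : Set H) (x - ∑ j ∈ S, proj (K j : Set H) x) = proj (K i : Set H) x := by
  classical
  induction S using Finset.induction_on generalizing i with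
  | empty => simp
  | insert l S hl ih =>
    rw [Finset.mem_insert, not_or] at hi
    rw [Finset.sum_insert hl, add_comm, ← sub_sub, ← ih hl,
      proj_sub_proj_of_orthogonal (hne l) (hcl l) (hne i) (hcl i) (h l i (Ne.symm hi.1)), ih hi.2]

theorem isClosed_sum_and_sum_proj_eq (hne : ∀ i, (K i : Set H).Nonempty)
    (hcl : ∀ i, IsClosed (K i : Set H))
    (h : ∀ i j, i ≠ j → ∀ x : H, ⟪proj (K i : Set H) x, proj (K j : Set H) x⟫ = 0)
    (J : Finset ι) :
    IsClosed (∑ j ∈ J, (K j : Set H)) ∧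
      ∀ x : H, ∑ j ∈ J, proj (K j : Set H) x = proj (∑ j ∈ J, (K j : Set H)) x := by
  classical
  obtain ⟨L, hL⟩ := exists_convexCone_coe_eq_sum K J
  have hmem : ∀ x : H, ∑ j ∈ J, proj (K j : Set H) x ∈ ∑ j ∈ J, (K j : Set H) := fun x =>
    Set.finsetSum_mem_finsetSum J _ _ fun i _ => proj_mem (hne i) (hcl i) x
  have hpol : ∀ x : H, ∀ k ∈ ∑ j ∈ J, (K j : Set H),
      ⟪x - ∑ j ∈ J, proj (K j : Set H) x, k⟫ ≤ 0 := by
    intro x k hk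
    obtain ⟨g, hg, rfl⟩ := (Set.mem_finsetSum _ _ _).1 hk
    rw [inner_sum]
    refine Finset.sum_nonpos fun i hi => ?_
    -- Subtracting the other components first leaves the i-th projection unchanged, so the residual
    -- here is that of the full sum.
    have := inner_sub_proj_nonpos (hne i) (hcl i)
      (x - ∑ j ∈ J.erase i, proj (K j : Set H) x) (hg hi)
    rwa [proj_sub_sum_proj hne hcl h _ (Finset.notMem_erase i J), sub_sub,
      Finset.sum_erase_add _ _ hi] at this
  have horth : ∀ x : H, ⟪x - ∑ j ∈ J, proj (K j : Set H) x, ∑ j ∈ J, proj (K j : Set H) x⟫ = 0 := by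
    intro x
    rw [inner_sum]
    refine Finset.sum_eq_zero fun i hi => ?_
    rw [inner_sub_left, sum_inner, Finset.sum_eq_single_of_mem i hi fun j _ hj => h j i hj x,
      ← inner_sub_left, inner_sub_proj_self (hne i) (hcl i)]
  have hnearest : ∀ x : H,
      IsNearest (∑ j ∈ J, (K j : Set H)) x (∑ j ∈ J, proj (K j : Set H) x) := fun x =>
    isNearest_of_inner_le_zero (hmem x) fun y hy => by
      rw [inner_sub_right, horth, sub_zero]
      exact hpol x y hy
  have hclosed : IsClosed (∑ j ∈ J, (K j : Set H)) := by
    -- A closure point is at distance 0 from its nearest point, hence equals it.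
    refine isClosed_of_closure_subset fun z hz => ?_
    have hz0 : ‖z - ∑ j ∈ J, proj (K j : Set H) z‖ ≤ 0 := by
      refine le_of_forall_pos_le_add fun ε hε => ?_
      obtain ⟨y, hy, hyz⟩ := Metric.mem_closure_iff.1 hz ε hε
      rw [dist_eq_norm] at hyz
      linarith [(hnearest z).2 y hy]
    rw [sub_eq_zero.1 (norm_le_zero_iff.1 hz0)]
    exact hmem z
  refine ⟨hclosed, fun x => (eq_proj_iff (nonempty_sum hne J) hclosed ?_ x _).2 (hnearest x)⟩
  rw [← hL]
  exact L.convex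

/-- If `Id` minus the sum of the projectors is monotone, the projections are pairwise
orthogonal. -/
theorem inner_proj_eq_zero_of_isMonotoneOperator (hne : ∀ i, (K i : Set H).Nonempty)
    (hcl : ∀ i, IsClosed (K i : Set H)) {J : Finset ι}
    (h : IsMonotoneOperator fun x : H => x - ∑ j ∈ J, proj (K j : Set H) x)
    {i j : ι} (hi : i ∈ J) (hj : j ∈ J) (hij : i ≠ j) (x : H) :
    ⟪proj (K i : Set H) x, proj (K j : Set H) x⟫ = 0 := by
  classical
  have hzero : ∀ l, proj (K l : Set H) (0 : H) = 0 := fun l =>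
    proj_of_mem (hne l) (hcl l) (zero_mem_cone (hne l) (hcl l))
  -- Monotonicity between k and 0 says that minus the sum of ‖P_l k‖² over l ≠ i is nonnegative.
  -- Thus k is polar to every other cone.
  have hproj : ∀ k ∈ K i, ∀ l ∈ J, l ≠ i → proj (K l : Set H) k = 0 := by
    intro k hk l hl hli
    have hmono := h k 0
    simp only [hzero, Finset.sum_const_zero, sub_zero, inner_sub_right, inner_sum] at hmono
    simp only [inner_proj (hne _) (hcl _)] at hmono
    rw [← Finset.add_sum_erase J _ hi, proj_of_mem (hne i) (hcl i) hk,
      real_inner_self_eq_norm_sq] at hmono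
    have hle := Finset.single_le_sum (f := fun l => ‖proj (K l : Set H) k‖ ^ 2)
      (fun l _ => sq_nonneg _) (Finset.mem_erase.2 ⟨hli, hl⟩)
    have h0 : ‖proj (K l : Set H) k‖ ^ 2 = 0 := le_antisymm (by linarith) (sq_nonneg _)
    rwa [sq_eq_zero_iff, norm_eq_zero] at h0
  set u := proj (K i : Set H) x with hu
  have hu_mem : u ∈ K i := proj_mem (hne i) (hcl i) x
  have hnonpos : ∀ l ∈ J.erase i, ⟪u, proj (K l : Set H) x⟫ ≤ 0 := by
    intro l hl
    obtain ⟨hli, hlJ⟩ := Finset.mem_erase.1 hl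
    have := inner_sub_proj_nonpos (hne l) (hcl l) u (proj_mem (hne l) (hcl l) x)
    rwa [hproj u hu_mem l hlJ hli, sub_zero] at this
  have hsum : -∑ l ∈ J.erase i, ⟪u, proj (K l : Set H) x⟫ ≤ 0 := by
    -- Id minus the sum vanishes on the ray through u, so the monotonicity inequality between x and
    -- t • u is affine in t; its slope is controlled by letting t → ∞.
    refine nonpos_of_forall_mul_le (b := ⟪x, x - ∑ l ∈ J, proj (K l : Set H) x⟫) fun t ht => ?_
    have htu : t • u ∈ K i := (K i).smul_mem ht hu_mem
    have hfix : ∑ l ∈ J, proj (K l : Set H) (t • u) = t • u := by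
      rw [Finset.sum_eq_single_of_mem i hi fun l hl hli => hproj _ htu l hl hli,
        proj_of_mem (hne i) (hcl i) htu]
    have hmono := h x (t • u)
    simp only [hfix, sub_self, sub_zero] at hmono
    rw [inner_sub_left, inner_smul_left, ← Finset.add_sum_erase J _ hi, ← sub_sub,
      inner_sub_right u, ← hu, real_inner_comm (x - u) u, inner_sub_proj_self (hne i) (hcl i), zero_sub,
      inner_sum] at hmono
    rw [← Finset.add_sum_erase J _ hi, ← sub_sub, ← hu]
    simp at hmono
    linarith
  have heq := (Finset.sum_eq_zero_iff_of_nonpos hnonpos).1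
    (le_antisymm (Finset.sum_nonpos hnonpos) (by linarith))
  exact heq j (Finset.mem_erase.2 ⟨hij.symm, hj⟩)

theorem IsConeProjector.isProximityOperator {T : H → H} (hT : IsConeProjector T) :
    IsProximityOperator T := by
  obtain ⟨L, hne, hcl, rfl⟩ := hT
  exact isProximityOperator_proj hne hcl L.convex

end Sum

end ConeSum

open ConeSum
theorem theoremc {H : Type*} [NormedAddCommGroup H] [InnerProductSpace ℝ H] [CompleteSpace H]
    {ι : Type*} [Fintype ι] (K : ι → ConvexCone ℝ H)
    (hne : ∀ i, (K i : Set H).Nonempty) (hcl : ∀ i, IsClosed (K i : Set H)) :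
    List.TFAE [
      ∀ i j, i ≠ j → ∀ x : H, inner ℝ (proj (K i : Set H) x) (proj (K j : Set H) x) = 0,
      IsClosed (∑ i, (K i : Set H)) ∧
        ∀ x : H, ∑ i, proj (K i : Set H) x = proj (∑ i, (K i : Set H)) x,
      IsConeProjector (fun x : H => ∑ i, proj (K i : Set H) x),
      IsProximityOperator (fun x : H => ∑ i, proj (K i : Set H) x),
      ∀ J : Finset ι, J.Nonempty →
        IsProximityOperator (fun x : H => ∑ j ∈ J, proj (K j : Set H) x),
      ∀ J : Finset ι, J.Nonempty →
        IsClosed (∑ j ∈ J, (K j : Set H)) ∧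
          ∀ x : H, ∑ j ∈ J, proj (K j : Set H) x = proj (∑ j ∈ J, (K j : Set H)) x,
      ∀ i j, i ≠ j → IsNonexpansive (fun x : H => proj (K i : Set H) x + proj (K j : Set H) x),
      ∀ i j, i ≠ j →
        IsMonotoneOperator (fun x : H => x - proj (K i : Set H) x - proj (K j : Set H) x)] := by
  classical
  tfae_have 1 → 2 := fun h => isClosed_sum_and_sum_proj_eq hne hcl h Finset.univ
  tfae_have 2 → 3 := fun h => isConeProjector_sum hne h.1 h.2
  tfae_have 3 → 4 := fun h => h.isProximityOperator
  tfae_have 4 → 1 := fun h i j hij x =>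
    inner_proj_eq_zero_of_isMonotoneOperator hne hcl h.isNonexpansive.isMonotoneOperator_sub
      (Finset.mem_univ i) (Finset.mem_univ j) hij x
  tfae_have 1 → 6 := fun h J _ => isClosed_sum_and_sum_proj_eq hne hcl h J
  tfae_have 6 → 5 := fun h J hJ =>
    (isConeProjector_sum hne (h J hJ).1 (h J hJ).2).isProximityOperator
  tfae_have 5 → 7 := fun h i j hij => by
    simpa only [Finset.sum_pair hij] using (h {i, j} (Finset.insert_nonempty i {j})).isNonexpansive
  tfae_have 7 → 8 := fun h i j hij => by
    simpa only [sub_sub] using (h i j hij).isMonotoneOperator_sub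
  tfae_have 8 → 1 := fun h i j hij x => by
    refine inner_proj_eq_zero_of_isMonotoneOperator hne hcl (J := {i, j}) ?_
      (Finset.mem_insert_self i {j}) (Finset.mem_insert_of_mem (Finset.mem_singleton_self j)) hij x
    simpa only [Finset.sum_pair hij, sub_sub] using h i j hij
  tfae_finish
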